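/- Let $n\ge 1$ and let $|E|$ denote the Lebesgue measure of $E\subseteq\mathbb R^n$. For a measurable function $g$ on $\mathbb R^n$ let $$g^*(t)=\inf\{s>0:\ |\{x:|g(x)|>s\}|\le t\},\qquad t>0,$$ be its decreasing rearrangement (with $\inf\emptyset=\infty$), and for $u\in L^1_{\rm loc}(\mathbb R^n)$ let $$Mu(x)=\sup_{Q\ni x}\frac1{|Q|}\int_Q|u(y)|\,dy$$ be the Hardy–Littlewood maximal function, the supremum being over all cubes $Q$ with sides parallel to the axes that contain $x$. Let $T$ be an operator (linearity or sublinearity is not needed) that maps each function $f$ of a class $D$ of measurable real- or complex-valued functions on $\mathbb R^n$ to a measurable function $Tf$ on $\mathbb R^n$. Suppose that $T$ satisfies the Fefferman–Stein inequality with a constant $C$: for every $f\in D$, every positive locally integrable function $u$ on $\mathbb R^n$ and every $y>0$, $$y\int_{\{x:\,|Tf(x)|>y\}}u(x)\,dx\le C\int_{\mathbb R^n}|f(x)|\,Mu(x)\,dx .$$ Then there is a finite constant $C'$, depending only on $n$ and $C$, such that for every $f\in D$ and every $t>0$, $$(Tf)^*(t)\le C'\left(\frac1t\int_0^t f^*(s)\,ds+\int_t^\infty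 f^*(s)\,\frac{ds}s\right),$$ where both sides may be infinite. -/

import Mathlib

open MeasureTheory Set
open scoped ENNReal NNReal

/-- The closed axis-parallel cube in `ℝⁿ` with lower corner `a` and side length `l`. -/
def cube {n : ℕ} (a : Fin n → ℝ) (l : ℝ) : Set (Fin n → ℝ) :=
  Icc a (fun i => a i + l)

/-- The (uncentred) Hardy–Littlewood maximal function: the supremum of the averages of `|u|`
over all cubes of positive side length containing `x`. -/
noncomputable def hardyLittlewoodMaximal {n : ℕ} (u : (Fin n → ℝ) → ℝ) (x : Fin n → ℝ) : ℝ≥0∞ :=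
  ⨆ (a : Fin n → ℝ) (l : ℝ) (_ : 0 < l) (_ : x ∈ cube a l),
    (volume (cube a l))⁻¹ * ∫⁻ y in cube a l, ‖u y‖ₑ

/-- The distribution function `s ↦ |{|g| > s}|` with respect to Lebesgue measure. -/
noncomputable def distributionFunction {n : ℕ} {F : Type*} [ENorm F]
    (g : (Fin n → ℝ) → F) (s : ℝ≥0∞) : ℝ≥0∞ :=
  volume {x | s < ‖g x‖ₑ}

/-- The decreasing rearrangement `g*(t) = inf {s > 0 : |{|g| > s}| ≤ t}`, used for `t > 0`. It is
`[0, ∞]`-valued, and equal to `∞` when no finite `s` is admissible. -/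
noncomputable def decreasingRearrangement {n : ℕ} {F : Type*} [ENorm F]
    (g : (Fin n → ℝ) → F) (t : ℝ) : ℝ≥0∞ :=
  sInf {s : ℝ≥0∞ | 0 < s ∧ distributionFunction g s ≤ ENNReal.ofReal t}

/-- The operator `T`, with domain `D`, satisfies the Fefferman–Stein inequality with constant `C`:
`y * ∫_{|Tf| > y} u ≤ C * ∫ |f| Mu` for every `f` in `D`, every positive locally integrable `u`
and every `y > 0`. -/
def SatisfiesFeffermanStein {n : ℕ} {𝕜 F : Type*} [RCLike 𝕜] [ENorm F]
    (D : Set ((Fin n → ℝ) → 𝕜)) (T : ((Fin n → ℝ) → 𝕜) → (Fin n → ℝ) → F) (C : ℝ≥0) : Prop :=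
  ∀ f ∈ D, ∀ u : (Fin n → ℝ) → ℝ, (∀ x, 0 < u x) → LocallyIntegrable u volume →
    ∀ y : ℝ, 0 < y →
      ENNReal.ofReal y * ∫⁻ x in {x | ENNReal.ofReal y < ‖T f x‖ₑ}, ENNReal.ofReal (u x)
        ≤ C * ∫⁻ x, ‖f x‖ₑ * hardyLittlewoodMaximal u x

/-! If `y < (Tf)*(t)`, then `S = {|Tf| > y}` has measure above `t`. Test the hypothesis on a weight
`u ≤ 2` with `∫ u ≤ 2t` and `∫_S u ≥ t` (`exists_pos_weight`): this gives `y t ≤ C ∫ |f| Mu`.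
Moreover `Mu ≤ 2`, and the weak type (1,1) bound gives `|{Mu > s}| ≤ b / s` with `b = 2 · 5^n t`.
Cut `Mu` at the levels `2^{-k}`. Since `∫_O |f| ≤ ∫_0^m f*` whenever `|O| ≤ m`, `∫ |f| Mu` is at
most `∑ 2^{1-k} ∫_0^{b 2^k} f* = ∫ f* K`, where `K(s) ≤ min(4, 4b/s)`. Splitting at `s = t` and
dividing by `t` gives the two Hardy terms (`lintegral_enorm_mul_le`). -/

/-! ### Bounds for the maximal function. -/

theorem cube_eq_closedBall {n : ℕ} (a : Fin n → ℝ) {l : ℝ} (hl : 0 < l) :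
    cube a l = Metric.closedBall (fun i => a i + l / 2) (l / 2) := by
  rw [closedBall_pi _ (by positivity)]
  ext x
  simp only [cube, Set.mem_Icc, Pi.le_def, Set.mem_pi, Real.closedBall_eq_Icc, Set.mem_univ,
    true_imp_iff]
  rw [← forall_and]
  refine forall_congr' fun i => and_congr ?_ ?_ <;> constructor <;> intro h <;> linarith

/-- The weak type `(1, 1)` inequality for the Hardy–Littlewood maximal function. -/
theorem mul_volume_lt_hardyLittlewoodMaximal_le {n : ℕ} (hn : 1 ≤ n) (u : (Fin n → ℝ) → ℝ)
    (hu : ∫⁻ x, ‖u x‖ₑ ≠ ∞) {s : ℝ≥0∞} (hs : s ≠ 0) (hs' : s ≠ ∞) :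
    s * volume {x | s < hardyLittlewoodMaximal u x} ≤ 5 ^ n * ∫⁻ x, ‖u x‖ₑ := by
  set I := ∫⁻ x, ‖u x‖ₑ
  -- Cubes are sup-norm balls, so Vitali's lemma applies to all cubes with average at least `s`. A
  -- cube witnessing `Mu x > s` lies in the fivefold enlargement of a selected one, whence the
  -- factor `5 ^ n`.
  let t : Set ((Fin n → ℝ) × ℝ) := {p | 0 < p.2 ∧
    s * volume (Metric.closedBall p.1 p.2) ≤ ∫⁻ y in Metric.closedBall p.1 p.2, ‖u y‖ₑ}
  -- Vitali needs bounded radii: for `r ≥ 1`, `r ≤ (2r)^n ≤ I / s`, which uses `n ≥ 1`.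
  have hR : ∀ p ∈ t, p.2 ≤ max 1 (I / s).toReal := by
    rintro ⟨c, r⟩ ⟨hr, h⟩
    simp only at hr h ⊢
    rcases le_total r 1 with h1 | h1
    · exact h1.trans (le_max_left _ _)
    refine le_trans ?_ (le_max_right _ _)
    rw [← ENNReal.ofReal_le_iff_le_toReal (ENNReal.div_ne_top hu hs),
      ENNReal.le_div_iff_mul_le (Or.inl hs) (Or.inl hs'), mul_comm]
    refine le_trans ?_ (h.trans (setLIntegral_le_lintegral _ _))
    rw [Real.volume_pi_closedBall c hr.le]
    gcongr
    calc r ≤ 2 * r := by linarith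
      _ ≤ (2 * r) ^ Fintype.card (Fin n) :=
        le_self_pow₀ (by linarith) (by simp; omega)
  obtain ⟨v, hvt, hdisj, hcov⟩ := Vitali.exists_disjoint_subfamily_covering_enlargement_closedBall
    t Prod.fst Prod.snd _ hR 5 (by norm_num)
  have hvc : v.Countable := by
    refine hdisj.countable_of_nonempty_interior fun p hp => ?_
    exact ⟨p.1, Metric.ball_subset_interior_closedBall (Metric.mem_ball_self (hvt hp).1)⟩
  have hsub : {x | s < hardyLittlewoodMaximal u x} ⊆
      ⋃ p ∈ v, Metric.closedBall p.1 (5 * p.2) := by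
    intro x hx
    simp only [Set.mem_ofPred_eq, hardyLittlewoodMaximal, lt_iSup_iff] at hx
    obtain ⟨a, l, hl, hxl, h⟩ := hx
    rw [cube_eq_closedBall a hl] at hxl h
    obtain ⟨p, hp, hsub⟩ := hcov (fun i => a i + l / 2, l / 2) ⟨by simpa using hl, by
      simp only
      refine (mul_le_mul_left h.le _).trans ?_
      rw [mul_comm, ← mul_assoc]
      exact (mul_le_mul_left (ENNReal.mul_inv_le_one _) _).trans_eq (one_mul _)⟩
    exact Set.mem_biUnion hp (hsub hxl)
  have hvol : ∀ p ∈ v, s * volume (Metric.closedBall p.1 (5 * p.2)) ≤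
      5 ^ n * ∫⁻ y in Metric.closedBall p.1 p.2, ‖u y‖ₑ := by
    intro p hp
    have hr := (hvt hp).1
    refine le_trans (le_of_eq ?_) (mul_le_mul_right (hvt hp).2 _)
    rw [Real.volume_pi_closedBall _ hr.le, Real.volume_pi_closedBall _ (by positivity),
      show 2 * (5 * p.2) = 5 * (2 * p.2) by ring, mul_pow,
      ENNReal.ofReal_mul (by positivity), ENNReal.ofReal_pow (by norm_num)]
    simp only [Fintype.card_fin, ENNReal.ofReal_ofNat]
    ring
  have := hvc.to_subtype
  calc s * volume {x | s < hardyLittlewoodMaximal u x}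
      ≤ s * ∑' p : v, volume (Metric.closedBall p.1.1 (5 * p.1.2)) := by
        gcongr
        exact (measure_mono hsub).trans (measure_biUnion_le _ hvc _)
    _ = ∑' p : v, s * volume (Metric.closedBall p.1.1 (5 * p.1.2)) := ENNReal.tsum_mul_left.symm
    _ ≤ ∑' p : v, 5 ^ n * ∫⁻ y in Metric.closedBall p.1.1 p.1.2, ‖u y‖ₑ :=
        ENNReal.tsum_le_tsum fun p => hvol p p.2
    _ = 5 ^ n * ∫⁻ y in ⋃ p ∈ v, Metric.closedBall p.1 p.2, ‖u y‖ₑ := by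
        rw [ENNReal.tsum_mul_left, lintegral_biUnion hvc (fun _ _ => measurableSet_closedBall)
          hdisj]
    _ ≤ 5 ^ n * I := by
        gcongr
        exact setLIntegral_le_lintegral _ _

theorem hardyLittlewoodMaximal_le {n : ℕ} (u : (Fin n → ℝ) → ℝ) {c : ℝ≥0∞}
    (hu : ∀ x, ‖u x‖ₑ ≤ c) (x : Fin n → ℝ) : hardyLittlewoodMaximal u x ≤ c := by
  refine iSup_le fun a => iSup_le fun l => iSup_le fun _ => iSup_le fun _ => ?_
  calc (volume (cube a l))⁻¹ * ∫⁻ y in cube a l, ‖u y‖ₑ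
      ≤ (volume (cube a l))⁻¹ * ∫⁻ _ in cube a l, c := by gcongr; exact hu _
    _ = ((volume (cube a l))⁻¹ * volume (cube a l)) * c := by
        rw [setLIntegral_const]; ring
    _ ≤ 1 * c := by gcongr; exact ENNReal.inv_mul_le_one _
    _ = c := one_mul c

/-! ### Distribution function and decreasing rearrangement. -/

theorem antitone_distributionFunction {n : ℕ} {F : Type*} [ENorm F] (g : (Fin n → ℝ) → F) :
    Antitone (distributionFunction g) :=
  fun _ _ h => measure_mono fun _ hx => lt_of_le_of_lt h hx

theorem antitone_decreasingRearrangement {n : ℕ} {F : Type*} [ENorm F] (g : (Fin n → ℝ) → F) :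
    Antitone (decreasingRearrangement g) :=
  fun _ _ h => sInf_le_sInf fun _ hs => ⟨hs.1, hs.2.trans (ENNReal.ofReal_le_ofReal h)⟩

theorem le_decreasingRearrangement {n : ℕ} {F : Type*} [ENorm F] {g : (Fin n → ℝ) → F}
    {s : ℝ≥0∞} {t : ℝ} (h : ENNReal.ofReal t < distributionFunction g s) :
    s ≤ decreasingRearrangement g t := by
  refine le_sInf fun r hr => ?_
  by_contra! hrs
  exact absurd (h.trans_le ((antitone_distributionFunction g hrs.le).trans hr.2)) (lt_irrefl _)

theorem lt_distributionFunction {n : ℕ} {F : Type*} [ENorm F] {g : (Fin n → ℝ) → F}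
    {s : ℝ≥0∞} {t : ℝ} (hs : 0 < s) (h : s < decreasingRearrangement g t) :
    ENNReal.ofReal t < distributionFunction g s := by
  by_contra! hle
  exact absurd (h.trans_le (sInf_le ⟨hs, hle⟩)) (lt_irrefl _)

/-- The integral of `|f|` over a set of measure at most `m` is at most the integral of the
decreasing rearrangement of `f` over `(0, m)`. -/
theorem setLIntegral_enorm_le_decreasingRearrangement {n : ℕ} {𝕜 : Type*} [RCLike 𝕜]
    {f : (Fin n → ℝ) → 𝕜} (hf : AEMeasurable f volume) {O : Set (Fin n → ℝ)} {m : ℝ}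
    (hO : volume O ≤ ENNReal.ofReal m) :
    ∫⁻ x in O, ‖f x‖ₑ ≤ ∫⁻ s in Ioo 0 m, decreasingRearrangement f s := by
  have hd : Measurable fun p : ℝ × ℝ => if ENNReal.ofReal p.2 < distributionFunction f
      (ENNReal.ofReal p.1) then (1 : ℝ≥0∞) else 0 := by
    refine Measurable.ite (measurableSet_lt (by fun_prop) ?_) measurable_const measurable_const
    exact (antitone_distributionFunction f).measurable.comp (by fun_prop)
  calc ∫⁻ x in O, ‖f x‖ₑ = ∫⁻ x in O, ENNReal.ofReal ‖f x‖ := by simp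
    _ = ∫⁻ r in Ioi 0, volume.restrict O {x | r < ‖f x‖} :=
        lintegral_eq_lintegral_meas_lt _ (.of_forall fun _ => norm_nonneg _) hf.restrict.norm
    _ ≤ ∫⁻ r in Ioi (0 : ℝ), ∫⁻ s in Ioo 0 m, if ENNReal.ofReal s < distributionFunction f
          (ENNReal.ofReal r) then 1 else 0 := by
        refine setLIntegral_mono' measurableSet_Ioi fun r hr => ?_
        set d := distributionFunction f (ENNReal.ofReal r)
        -- Layer cake: the level set inside `O` has measure at most `min(m, d)`, the length of `{s ∈
        -- (0, m) : s < d}`. Tonelli then exchanges `r` and `s`.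
        have h1 : volume.restrict O {x | r < ‖f x‖} ≤ min (ENNReal.ofReal m) d := by
          refine le_min ?_ ?_
          · exact (measure_mono (subset_univ _)).trans (by simpa using hO)
          · refine (Measure.restrict_apply_le _ _).trans (measure_mono fun x hx => ?_)
            simp only [Set.mem_ofPred_eq] at hx ⊢
            rw [← ofReal_norm]
            exact (ENNReal.ofReal_lt_ofReal_iff (lt_trans hr hx)).2 hx
        refine h1.trans ?_
        set e := min (ENNReal.ofReal m) d
        have he : e ≠ ∞ := ((min_le_left _ _).trans_lt ENNReal.ofReal_lt_top).ne
        have h2 : ∀ s ∈ Ioo 0 e.toReal, s ∈ Ioo 0 m ∧ ENNReal.ofReal s < d := by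
          intro s hs
          have h3 : ENNReal.ofReal s < e := (ENNReal.ofReal_lt_iff_lt_toReal hs.1.le he).2 hs.2
          have h4 := h3.trans_le (min_le_left _ _)
          exact ⟨⟨hs.1, (ENNReal.ofReal_lt_ofReal_iff_of_nonneg hs.1.le).1 h4⟩,
            h3.trans_le (min_le_right _ _)⟩
        calc e = ∫⁻ s in Ioo 0 e.toReal, 1 := by simp [he]
          _ = ∫⁻ s in Ioo 0 e.toReal, if ENNReal.ofReal s < d then 1 else 0 :=
            setLIntegral_congr_fun measurableSet_Ioo fun s hs => by simp [(h2 s hs).2]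
          _ ≤ _ := lintegral_mono_set fun s hs => (h2 s hs).1
    _ = ∫⁻ s in Ioo 0 m, ∫⁻ r in Ioi (0 : ℝ), if ENNReal.ofReal s < distributionFunction f
          (ENNReal.ofReal r) then 1 else 0 := lintegral_lintegral_swap hd.aemeasurable
    _ ≤ ∫⁻ s in Ioo 0 m, decreasingRearrangement f s := by
        refine lintegral_mono fun s => ?_
        set e := decreasingRearrangement f s
        by_cases htop : e = ∞
        · simp [htop]
        -- `s < d(r)` forces `r ≤ f*(s)`, so the `r`-integral is at most `f*(s)`.
        calc ∫⁻ r in Ioi (0 : ℝ), (if ENNReal.ofReal s < distributionFunction f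
              (ENNReal.ofReal r) then 1 else 0)
            ≤ ∫⁻ r in Ioi (0 : ℝ), (Iic e.toReal).indicator 1 r := by
              refine setLIntegral_mono' measurableSet_Ioi fun r hr => ?_
              split_ifs with h
              · have : r ∈ Iic e.toReal := by
                  rw [Set.mem_Iic, ← ENNReal.ofReal_le_iff_le_toReal htop]
                  exact le_decreasingRearrangement h
                simp [this]
              · simp
          _ = e := by
              rw [lintegral_indicator_one measurableSet_Iic,
                Measure.restrict_apply measurableSet_Iic, inter_comm, Ioi_inter_Iic]
              simp [htop]

/-! ### Dyadic decomposition of a weight. -/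

theorem tsum_two_mul_inv_two_pow : ∑' k : ℕ, 2 * (2⁻¹ : ℝ≥0∞) ^ k = 4 := by
  rw [ENNReal.tsum_mul_left, ENNReal.tsum_geometric, ENNReal.one_sub_inv_two, inv_inv]
  norm_num

/-- For the first `k` with `2^{-k} < M`, minimality (or `M ≤ 2` when `k = 0`) gives `M ≤ 2 ·
2^{-k}`, so one term suffices. -/
theorem le_tsum_dyadic {M : ℝ≥0∞} (hM : M ≤ 2) :
    M ≤ ∑' k : ℕ, if (2⁻¹ : ℝ≥0∞) ^ k < M then 2 * (2⁻¹ : ℝ≥0∞) ^ k else 0 := by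
  classical
  rcases eq_or_ne M 0 with rfl | h0
  · exact zero_le
  have hex : ∃ k : ℕ, (2⁻¹ : ℝ≥0∞) ^ k < M := ENNReal.exists_inv_two_pow_lt h0
  refine le_trans ?_ (ENNReal.le_tsum (Nat.find hex))
  rw [if_pos (Nat.find_spec hex)]
  rcases h : Nat.find hex with _ | k
  · simpa using hM
  · have := Nat.find_min hex (m := k) (by omega)
    rw [pow_succ, mul_comm (2 : ℝ≥0∞), mul_assoc,
      ENNReal.inv_mul_cancel (by norm_num) (by norm_num), mul_one]
    exact not_lt.1 this

/-- Only the geometric tail from the first `m` with `s < b 2^m` survives; it is at most `4 · 2^{-m}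
≤ 4b / s`. -/
theorem tsum_dyadic_le {b s : ℝ} (hb : 0 < b) (hs : 0 < s) :
    ∑' k : ℕ, (if s < b * 2 ^ k then 2 * (2⁻¹ : ℝ≥0∞) ^ k else 0) ≤
      4 * ENNReal.ofReal b / ENNReal.ofReal s := by
  classical
  have hex : ∃ k : ℕ, s < b * 2 ^ k := by
    obtain ⟨k, hk⟩ := pow_unbounded_of_one_lt (s / b) (one_lt_two (α := ℝ))
    exact ⟨k, by rwa [div_lt_iff₀' hb] at hk⟩
  set m := Nat.find hex
  rw [← ENNReal.summable.sum_add_tsum_nat_add' (k := m), Finset.sum_eq_zero, zero_add]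
  · calc ∑' k : ℕ, (if s < b * 2 ^ (k + m) then 2 * (2⁻¹ : ℝ≥0∞) ^ (k + m) else 0)
        ≤ ∑' k : ℕ, 2 * (2⁻¹ : ℝ≥0∞) ^ k * 2⁻¹ ^ m := by
          refine ENNReal.tsum_le_tsum fun k => ?_
          split_ifs
          · rw [pow_add, mul_assoc]
          · exact zero_le
      _ = 4 * 2⁻¹ ^ m := by rw [ENNReal.tsum_mul_right, tsum_two_mul_inv_two_pow]
      _ ≤ 4 * (ENNReal.ofReal b / ENNReal.ofReal s) := by
          gcongr
          have h := (Nat.find_spec hex).le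
          rw [ENNReal.le_div_iff_mul_le (by simp [hs]) (by simp), ← ENNReal.inv_pow, mul_comm,
            ← div_eq_mul_inv]
          refine ENNReal.div_le_of_le_mul ?_
          rw [← ENNReal.ofReal_ofNat 2, ← ENNReal.ofReal_pow (by norm_num),
            ← ENNReal.ofReal_mul hb.le]
          exact ENNReal.ofReal_le_ofReal h
      _ = _ := (mul_div_assoc _ _ _).symm
  · intro k hk
    exact if_neg (Nat.find_min hex (Finset.mem_range.1 hk))

/-- A bounded weight whose distribution function decays like `b / s` pairs with `|f|` as the
sum of the Hardy operator and its adjoint, applied to the decreasing rearrangement of `f`. -/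
theorem lintegral_enorm_mul_le {n : ℕ} {𝕜 : Type*} [RCLike 𝕜] {f : (Fin n → ℝ) → 𝕜}
    (hf : AEMeasurable f volume) {g : (Fin n → ℝ) → ℝ≥0∞} (hg : ∀ x, g x ≤ 2) {b : ℝ}
    (hb : 0 < b) (hgb : ∀ k : ℕ, volume {x | (2⁻¹ : ℝ≥0∞) ^ k < g x} ≤ ENNReal.ofReal (b * 2 ^ k))
    {t : ℝ} (ht : 0 < t) :
    ∫⁻ x, ‖f x‖ₑ * g x ≤ 4 * (∫⁻ s in Ioo 0 t, decreasingRearrangement f s) +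
      4 * ENNReal.ofReal b * ∫⁻ s in Ioi t, decreasingRearrangement f s / ENNReal.ofReal s := by
  classical
  let c : ℕ → ℝ≥0∞ := fun k => 2 * 2⁻¹ ^ k
  -- Measurable hulls keep the measure bounds and make measurability of `g` unnecessary.
  let O : ℕ → Set (Fin n → ℝ) := fun k => toMeasurable volume {x | (2⁻¹ : ℝ≥0∞) ^ k < g x}
  have hO : ∀ k, MeasurableSet (O k) := fun k => measurableSet_toMeasurable _ _
  have hfm : Measurable (decreasingRearrangement f) :=
    (antitone_decreasingRearrangement f).measurable
  -- The kernel left after summing over `k`: the bound 4 serves on `(0, t)`, the decay `4b / s`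
  -- beyond `t`.
  let K : ℝ → ℝ≥0∞ := fun s => ∑' k : ℕ, if s < b * 2 ^ k then c k else 0
  have hK4 : ∀ s, K s ≤ 4 := fun s => by
    rw [← tsum_two_mul_inv_two_pow]
    exact ENNReal.tsum_le_tsum fun k => by
      simp only [c]
      split_ifs
      · exact le_rfl
      · exact zero_le
  have h1 : ∀ x, ‖f x‖ₑ * g x ≤ ∑' k, c k * (O k).indicator (fun x => ‖f x‖ₑ) x := by
    intro x
    refine (mul_le_mul_right (le_tsum_dyadic (hg x)) _).trans ?_
    rw [← ENNReal.tsum_mul_left]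
    refine ENNReal.tsum_le_tsum fun k => ?_
    split_ifs with h
    · have : x ∈ O k := subset_toMeasurable _ _ h
      simp [c, this, mul_comm]
    · simp
  have h2 : ∀ k, ∫⁻ s in Ioo 0 (b * 2 ^ k), decreasingRearrangement f s =
      ∫⁻ s in Ioi 0, if s < b * 2 ^ k then decreasingRearrangement f s else 0 := by
    intro k
    have : (fun s => if s < b * 2 ^ k then decreasingRearrangement f s else 0) =
        (Iio (b * 2 ^ k)).indicator (decreasingRearrangement f) := by
      ext s; simp [Set.indicator]
    rw [this, setLIntegral_indicator measurableSet_Iio, inter_comm, Ioi_inter_Iio]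
  calc ∫⁻ x, ‖f x‖ₑ * g x
      ≤ ∫⁻ x, ∑' k, c k * (O k).indicator (fun x => ‖f x‖ₑ) x := lintegral_mono h1
    _ = ∑' k, c k * ∫⁻ x in O k, ‖f x‖ₑ := by
        rw [lintegral_tsum fun k => (hf.enorm.indicator (hO k)).const_mul _]
        refine tsum_congr fun k => ?_
        rw [lintegral_const_mul'' _ (hf.enorm.indicator (hO k)), lintegral_indicator (hO k)]
    _ ≤ ∑' k, c k * ∫⁻ s in Ioo 0 (b * 2 ^ k), decreasingRearrangement f s := by
        gcongr with k
        exact setLIntegral_enorm_le_decreasingRearrangement hf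
          ((measure_toMeasurable _).trans_le (hgb k))
    _ = ∫⁻ s in Ioi 0, decreasingRearrangement f s * K s := by
        have hm : ∀ k, Measurable fun s : ℝ =>
            if s < b * 2 ^ k then decreasingRearrangement f s else 0 := fun k =>
          Measurable.ite measurableSet_Iio hfm measurable_const
        simp_rw [h2, ← lintegral_const_mul _ (hm _)]
        rw [← lintegral_tsum fun k => ((hm k).const_mul _).aemeasurable]
        refine lintegral_congr fun s => ?_
        rw [← ENNReal.tsum_mul_left]
        refine tsum_congr fun k => ?_
        split_ifs
        · exact mul_comm _ _
        · simp
    _ = (∫⁻ s in Ioo 0 t, decreasingRearrangement f s * K s) +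
          ∫⁻ s in Ioi t, decreasingRearrangement f s * K s := by
        rw [← Ioc_union_Ioi_eq_Ioi ht.le, lintegral_union measurableSet_Ioi
          (Ioc_disjoint_Ioi le_rfl), setLIntegral_congr Ioo_ae_eq_Ioc]
    _ ≤ (∫⁻ s in Ioo 0 t, 4 * decreasingRearrangement f s) + ∫⁻ s in Ioi t,
          4 * ENNReal.ofReal b * (decreasingRearrangement f s / ENNReal.ofReal s) := by
        refine add_le_add (lintegral_mono fun s => ?_)
          (setLIntegral_mono' measurableSet_Ioi fun s hs => ?_)
        · rw [mul_comm]
          exact mul_le_mul_left (hK4 s) _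
        · refine (mul_le_mul_right (tsum_dyadic_le hb (ht.trans hs)) _).trans_eq ?_
          simp only [div_eq_mul_inv]
          ring
    _ = _ := by
        rw [lintegral_const_mul _ hfm, lintegral_const_mul _ (by fun_prop)]

/-! ### The test weight and the conclusion. -/

/-- A set of measure greater than `t` carries at least the mass `t` of some positive weight that
is bounded by `2` and has integral at most `2 t`. -/
theorem exists_pos_weight {n : ℕ} {S : Set (Fin n → ℝ)} (hS : NullMeasurableSet S volume) {t : ℝ}
    (ht : 0 < t) (htS : ENNReal.ofReal t < volume S) :
    ∃ u : (Fin n → ℝ) → ℝ, (∀ x, 0 < u x) ∧ Integrable u volume ∧ (∀ x, u x ≤ 2) ∧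
      ∫⁻ x, ENNReal.ofReal (u x) ≤ ENNReal.ofReal (2 * t) ∧
      ENNReal.ofReal t ≤ ∫⁻ x in S, ENNReal.ofReal (u x) := by
  obtain ⟨S₁, hS₁, hS₁m, hS₁S⟩ := hS.exists_measurable_subset_ae_eq
  rw [← measure_congr hS₁S] at htS
  obtain ⟨A, hA, hAS, htA, hAtop⟩ := Measure.exists_subset_measure_lt_top hS₁m htS
  obtain ⟨w, hw, hwm, hwt⟩ := exists_pos_lintegral_lt_of_sigmaFinite
    (volume : Measure (Fin n → ℝ)) (ε := ENNReal.ofReal t) (by simpa using ht)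
  set v := (volume A).toReal
  have hvA : volume A = ENNReal.ofReal v := (ENNReal.ofReal_toReal hAtop.ne).symm
  rw [hvA] at htA
  have htv : t < v := (ENNReal.ofReal_lt_ofReal_iff_of_nonneg ht.le).1 htA
  have hv0 : 0 < v := ht.trans htv
  -- Scaling the indicator of `A` to mass `t` avoids finding a subset of measure exactly `t`; `q`,
  -- of integral below `t`, makes the weight strictly positive.
  let p : (Fin n → ℝ) → ℝ := A.indicator fun _ => t / v
  let q : (Fin n → ℝ) → ℝ := fun x => min (w x : ℝ) 1
  have hp0 : ∀ x, 0 ≤ p x := indicator_nonneg fun _ _ => by positivity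
  have hq0 : ∀ x, 0 < q x := fun x => lt_min (hw x) one_pos
  have hpm : Measurable p := measurable_const.indicator hA
  have hqm : Measurable q := by fun_prop
  have hofp : ∀ x, ENNReal.ofReal (p x) = A.indicator (fun _ => ENNReal.ofReal (t / v)) x :=
    fun x => by by_cases hx : x ∈ A <;> simp [p, hx]
  have hpA : ENNReal.ofReal (t / v) * volume A = ENNReal.ofReal t := by
    rw [hvA, ← ENNReal.ofReal_mul (by positivity), div_mul_cancel₀ _ hv0.ne']
  have hint : ∫⁻ x, ENNReal.ofReal (p x + q x) ≤ ENNReal.ofReal (2 * t) := by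
    simp_rw [fun x => ENNReal.ofReal_add (hp0 x) (hq0 x).le]
    rw [lintegral_add_left hpm.ennreal_ofReal, two_mul, ENNReal.ofReal_add ht.le ht.le]
    refine add_le_add ?_ (le_trans (lintegral_mono fun x => ?_) hwt.le)
    · simp_rw [hofp]
      rw [lintegral_indicator_const hA, hpA]
    · exact (ENNReal.ofReal_le_ofReal (min_le_left _ _)).trans_eq (ENNReal.ofReal_coe_nnreal)
  have hpos : ∀ x, 0 < p x + q x := fun x => add_pos_of_nonneg_of_pos (hp0 x) (hq0 x)
  refine ⟨fun x => p x + q x, hpos, ⟨(hpm.add hqm).aestronglyMeasurable, ?_⟩, fun x => ?_, hint, ?_⟩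
  · rw [hasFiniteIntegral_iff_ofReal (.of_forall fun x => (hpos x).le)]
    exact hint.trans_lt ENNReal.ofReal_lt_top
  · have h1 : p x ≤ 1 := indicator_le' (fun _ _ => by rw [div_le_one hv0]; exact htv.le)
      (fun _ _ => zero_le_one) x
    have h2 : q x ≤ 1 := min_le_right _ _
    linarith
  · calc ENNReal.ofReal t = ∫⁻ x in A, ENNReal.ofReal (t / v) := by
          rw [setLIntegral_const, hpA]
      _ ≤ ∫⁻ x in A, ENNReal.ofReal (p x + q x) := by
          refine setLIntegral_mono' hA fun x hx => ENNReal.ofReal_le_ofReal ?_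
          simpa [p, hx] using (hq0 x).le
      _ ≤ _ := lintegral_mono_set (hAS.trans hS₁)

theorem mainTheorem10 {𝕜 F : Type*} [RCLike 𝕜] [ENorm F] (n : ℕ) (hn : 1 ≤ n) (C : ℝ≥0) :
    ∃ C' : ℝ≥0, ∀ (D : Set ((Fin n → ℝ) → 𝕜)) (T : ((Fin n → ℝ) → 𝕜) → (Fin n → ℝ) → F),
      (∀ f ∈ D, AEMeasurable f volume) →
      (∀ f ∈ D, AEMeasurable (fun x => ‖T f x‖ₑ) volume) →
      SatisfiesFeffermanStein D T C →
      ∀ f ∈ D, ∀ t : ℝ, 0 < t →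
        decreasingRearrangement (T f) t ≤
          C' * ((ENNReal.ofReal t)⁻¹ * (∫⁻ s in Ioo 0 t, decreasingRearrangement f s) +
            ∫⁻ s in Ioi t, decreasingRearrangement f s / ENNReal.ofReal s) := by
  -- `4b / t = 8 · 5 ^ n` is the coefficient of the tail integral and dominates the 4 of the other
  -- term. Arguing below `(Tf)*(t)` also covers an infinite value.
  refine ⟨C * (8 * 5 ^ n), fun D T hD hT hFS f hf t ht => le_of_forall_lt fun y' hy' => ?_⟩
  set I := ∫⁻ s in Ioo 0 t, decreasingRearrangement f s
  set J := ∫⁻ s in Ioi t, decreasingRearrangement f s / ENNReal.ofReal s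
  obtain ⟨y, hy'y, hy⟩ := ENNReal.lt_iff_exists_nnreal_btwn.1 hy'
  refine hy'y.trans_le ?_
  have hy0 : 0 < y := by exact_mod_cast zero_le.trans_lt hy'y
  have hofy : ENNReal.ofReal (y : ℝ) = y := ENNReal.ofReal_coe_nnreal
  have hlt : ENNReal.ofReal t < volume {x | ENNReal.ofReal y < ‖T f x‖ₑ} := by
    rw [hofy]
    exact lt_distributionFunction (by exact_mod_cast hy0) hy
  obtain ⟨u, hu0, hui, hu2, hu, htu⟩ :=
    exists_pos_weight (nullMeasurableSet_lt aemeasurable_const (hT f hf)) ht hlt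
  have hue : ∀ x, ‖u x‖ₑ = ENNReal.ofReal (u x) := fun x => Real.enorm_of_nonneg (hu0 x).le
  have hFSu := hFS f hf u hu0 hui.locallyIntegrable y (by exact_mod_cast hy0)
  have hM2 : ∀ x, hardyLittlewoodMaximal u x ≤ 2 := hardyLittlewoodMaximal_le u fun x => by
    rw [hue, ← ENNReal.ofReal_ofNat 2]
    exact ENNReal.ofReal_le_ofReal (hu2 x)
  have hweak : ∀ k : ℕ, volume {x | (2⁻¹ : ℝ≥0∞) ^ k < hardyLittlewoodMaximal u x} ≤
      ENNReal.ofReal (5 ^ n * (2 * t) * 2 ^ k) := by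
    intro k
    have h := mul_volume_lt_hardyLittlewoodMaximal_le hn u
      (by simpa only [hue] using (hu.trans_lt ENNReal.ofReal_lt_top).ne)
      (s := 2⁻¹ ^ k) (by simp) (by simp)
    simp only [hue] at h
    generalize volume {x | (2⁻¹ : ℝ≥0∞) ^ k < hardyLittlewoodMaximal u x} = V at h ⊢
    rw [← ENNReal.inv_pow, mul_comm, ← div_eq_mul_inv,
      ENNReal.div_le_iff (by simp) (by simp)] at h
    rw [ENNReal.ofReal_mul (by positivity), ENNReal.ofReal_mul (by positivity),
      ENNReal.ofReal_pow (by norm_num), ENNReal.ofReal_pow (by norm_num)]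
    simp only [ENNReal.ofReal_ofNat]
    exact h.trans (by gcongr)
  have hmain := lintegral_enorm_mul_le (hD f hf) hM2 (b := 5 ^ n * (2 * t)) (by positivity) hweak ht
  have ht0 : ENNReal.ofReal t ≠ 0 := by simpa using ht
  have hb : ENNReal.ofReal (5 ^ n * (2 * t)) = 5 ^ n * (2 * ENNReal.ofReal t) := by
    rw [ENNReal.ofReal_mul (by positivity), ENNReal.ofReal_mul (by positivity),
      ENNReal.ofReal_pow (by norm_num)]
    simp only [ENNReal.ofReal_ofNat]
  rw [hb] at hmain
  rw [hofy] at hFSu htu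
  have h48 : (4 : ℝ≥0∞) ≤ 8 * 5 ^ n := by
    calc (4 : ℝ≥0∞) ≤ 8 * 1 := by norm_num
      _ ≤ 8 * 5 ^ n := by gcongr; exact one_le_pow₀ (by norm_num)
  have hcancel : ENNReal.ofReal t * (ENNReal.ofReal t)⁻¹ = 1 :=
    ENNReal.mul_inv_cancel ht0 ENNReal.ofReal_ne_top
  rw [← ENNReal.mul_le_mul_iff_left ht0 ENNReal.ofReal_ne_top]
  calc (y : ℝ≥0∞) * ENNReal.ofReal t
      ≤ y * ∫⁻ x in {x | (y : ℝ≥0∞) < ‖T f x‖ₑ}, ENNReal.ofReal (u x) := by gcongr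
    _ ≤ C * ∫⁻ x, ‖f x‖ₑ * hardyLittlewoodMaximal u x := hFSu
    _ ≤ C * (4 * I + 4 * (5 ^ n * (2 * ENNReal.ofReal t)) * J) := by gcongr
    _ ≤ C * (8 * 5 ^ n * I + 4 * (5 ^ n * (2 * ENNReal.ofReal t)) * J) := by gcongr
    _ = C * (8 * 5 ^ n * ((ENNReal.ofReal t * (ENNReal.ofReal t)⁻¹) * I) +
          4 * (5 ^ n * (2 * ENNReal.ofReal t)) * J) := by rw [hcancel, one_mul]
    _ = _ := by push_cast; ring
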